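/- For a graph $K$ and a graph $\Gamma$, a $(K,\Gamma)$-design is a set $\mathcal B$ of subgraphs of $K$ (called blocks), each isomorphic to $\Gamma$, whose edge sets partition the edge set of $K$. A $\Gamma$-design of order $v$ is a $(K_v,\Gamma)$-design, where $K_v$ is a complete graph on $v$ vertices, and $v$ is admissible for $\Gamma$ if such a design exists. A down-link from a $\Gamma$-design $\mathcal B$ of order $v$ to a $\Gamma'$-design $\mathcal B'$ of order $n$ is a map $f:\mathcal B\to\mathcal B'$ such that $f(B)$ is a subgraph of $B$ for every $B\in\mathcal B$; the vertex sets of the two designs are finite subsets of one common infinite set of labels and may overlap in any way. Let $P_k$ denote the path on $k$ vertices. With $\Gamma'=P_3$, let $\mathcal L_1\Gamma(v)$ be the set of all integers $n\ge 0$ such that some $\Gamma$-design of order $v$ can be down-linked to a $P_3$-design of order $n$, and let $\mathcal L_2\Gamma(v)$ be the set of all integers $n\ge 0$ such that every $\Gamma$-design of order $v$ can be down-linked to some $P_3$-design of order $n$. Theorem. Let $k>4$, and let $v>1$ be admissible for $P_k$. Then \[\left\{n\ge v-\left\lfloor\frac{k-6}{3}\right\rfloor \;:\; n\equiv 0,1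 \pmod 4\right\}\subseteq \mathcal L_2P_k(v)\subseteq \mathcal L_1P_k(v).\] -/

import Mathlib

/-- A simple graph whose vertices are taken from the label set `α`: a vertex set together with
a set of edges on it. The order `B' ≤ B` on these is "`B'` is a subgraph of `B`". -/
abbrev LabelledGraph (α : Type*) := (⊤ : SimpleGraph α).Subgraph

/-- The complete graph with vertex set `X`. -/
def completeOn {α : Type*} (X : Set α) : LabelledGraph α :=
  (⊤ : LabelledGraph α).induce X

/-- `𝓑` is a `(K, Γ)`-design: a set of subgraphs of `K` (the blocks), each isomorphic to `Γ`,
whose edge sets partition the edge set of `K`. -/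
structure IsGraphDesign {α W : Type*} (K : LabelledGraph α) (Γ : SimpleGraph W)
    (𝓑 : Set (LabelledGraph α)) : Prop where
  block_le : ∀ B ∈ 𝓑, B ≤ K
  block_iso : ∀ B ∈ 𝓑, Nonempty (B.coe ≃g Γ)
  existsUnique_block : ∀ e ∈ K.edgeSet, ∃! B, B ∈ 𝓑 ∧ e ∈ B.edgeSet

/-- `𝓑` is a `Γ`-design of order `v`, that is, a `(K_v, Γ)`-design, on some set of `v` labels. -/
def IsDesignOfOrder {α W : Type*} (Γ : SimpleGraph W) (v : ℕ)
    (𝓑 : Set (LabelledGraph α)) : Prop :=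
  ∃ X : Finset α, X.card = v ∧ IsGraphDesign (completeOn (X : Set α)) Γ 𝓑

/-- A map `f : 𝓑 → 𝓑'` is a down-link if `f B` is a subgraph of `B` for every block `B`. -/
def IsDownLink {α : Type*} {𝓑 𝓑' : Set (LabelledGraph α)} (f : 𝓑 → 𝓑') : Prop :=
  ∀ B : 𝓑, (f B : LabelledGraph α) ≤ (B : LabelledGraph α)

/-- `v` is admissible for `Γ` if a `Γ`-design of order `v` exists. -/
def IsAdmissibleOrder (α : Type*) {W : Type*} (Γ : SimpleGraph W) (v : ℕ) : Prop :=
  ∃ 𝓑 : Set (LabelledGraph α), IsDesignOfOrder Γ v 𝓑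

/-- `𝓛₁Γ(v)` with respect to `Γ'`: the orders `n` such that some `Γ`-design of order `v` can be
down-linked to a `Γ'`-design of order `n`. -/
def downLinkSpectrum₁ (α : Type*) {W W' : Type*} (Γ : SimpleGraph W) (Γ' : SimpleGraph W')
    (v : ℕ) : Set ℕ :=
  {n | ∃ 𝓑 : Set (LabelledGraph α), IsDesignOfOrder Γ v 𝓑 ∧
    ∃ 𝓑' : Set (LabelledGraph α), IsDesignOfOrder Γ' n 𝓑' ∧ ∃ f : 𝓑 → 𝓑', IsDownLink f}

/-- `𝓛₂Γ(v)` with respect to `Γ'`: the orders `n` such that every `Γ`-design of order `v` can be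
down-linked to a `Γ'`-design of order `n`. -/
def downLinkSpectrum₂ (α : Type*) {W W' : Type*} (Γ : SimpleGraph W) (Γ' : SimpleGraph W')
    (v : ℕ) : Set ℕ :=
  {n | ∀ 𝓑 : Set (LabelledGraph α), IsDesignOfOrder Γ v 𝓑 →
    ∃ 𝓑' : Set (LabelledGraph α), IsDesignOfOrder Γ' n 𝓑' ∧ ∃ f : 𝓑 → 𝓑', IsDownLink f}

/-! Put `m = ⌊k/3⌋ - 1`, so that the hypothesis on `n` reads `v - m < n`. Delete any `m` of the `v`
vertices. A path on `k` vertices contains `m + 1` disjoint runs of three consecutive vertices, so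
every block keeps a `P₃` avoiding the deleted set (`exists_threePath_le_disjoint`). These are
edge-disjoint and span at most `v - m < n` vertices, hence lie in a `K_n` having a vertex `y` that
none of them meets. The rest of `K_n` has evenly many edges and contains the full star at `y`.
Assign each edge to one of its ends: away from `y` arbitrarily, then use the edge `yx` to make the
number assigned to `x` even. The count at `y` is then even too, and pairing the edges at each vertex
gives the missing paths (`exists_threePathPartition_of_universal`). -/

/-! ### Three-vertex paths as labelled subgraphs -/

/-- The path `g 0, g 1, g 2` in the complete graph on `α`, as a subgraph. -/
def threePath {α : Type*} (g : Fin 3 ↪ α) : LabelledGraph α :=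
  (SimpleGraph.Embedding.toCopy (SimpleGraph.Embedding.completeGraph g) |>.comp
    (SimpleGraph.Copy.ofLE (SimpleGraph.pathGraph 3) ⊤ le_top)).toSubgraph

theorem threePath_verts {α : Type*} (g : Fin 3 ↪ α) : (threePath g).verts = Set.range g := by
  ext x
  simp [threePath, SimpleGraph.Copy.toSubgraph]

theorem threePath_adj {α : Type*} (g : Fin 3 ↪ α) (x y : α) :
    (threePath g).Adj x y ↔ ∃ i j, (SimpleGraph.pathGraph 3).Adj i j ∧ g i = x ∧ g j = y := by
  simp [threePath, SimpleGraph.Copy.toSubgraph, Relation.Map]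

theorem threePath_iso {α : Type*} (g : Fin 3 ↪ α) :
    Nonempty ((threePath g).coe ≃g SimpleGraph.pathGraph 3) :=
  ⟨(SimpleGraph.Copy.isoToSubgraph _).symm⟩

theorem threePath_edgeSet {α : Type*} (g : Fin 3 ↪ α) :
    (threePath g).edgeSet = {s(g 0, g 1), s(g 1, g 2)} := by
  ext e
  induction e with
  | _ x y =>
    rw [SimpleGraph.Subgraph.mem_edgeSet, threePath_adj]
    simp only [SimpleGraph.pathGraph_adj, Fin.exists_fin_succ, Set.mem_insert_iff,
      Set.mem_singleton_iff, Sym2.eq_iff]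
    simp
    grind

theorem exists_mem_edgeSet_threePath {α : Type*} (g : Fin 3 ↪ α) {x : α}
    (hx : x ∈ (threePath g).verts) : ∃ e ∈ (threePath g).edgeSet, x ∈ e := by
  rw [threePath_verts] at hx
  obtain ⟨i, rfl⟩ := hx
  rw [threePath_edgeSet]
  fin_cases i <;> simp

theorem even_ncard_threePath_edgeSet {α : Type*} (g : Fin 3 ↪ α) :
    Even (threePath g).edgeSet.ncard := by
  rw [threePath_edgeSet, Set.ncard_pair]
  · exact even_two
  · have h := g.injective.ne (show (0 : Fin 3) ≠ 2 by decide)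
    have h' := g.injective.ne (show (0 : Fin 3) ≠ 1 by decide)
    simp [h, h']

/-! ### Partitions of edge sets into three-vertex paths -/

/-- `𝓑` is a set of three-vertex paths whose edge sets partition `E`. -/
structure IsThreePathPartition {α : Type*} (E : Set (Sym2 α)) (𝓑 : Set (LabelledGraph α)) :
    Prop where
  exists_eq : ∀ B ∈ 𝓑, ∃ g, B = threePath g
  edgeSet_subset : ∀ B ∈ 𝓑, B.edgeSet ⊆ E
  existsUnique_block : ∀ e ∈ E, ∃! B, B ∈ 𝓑 ∧ e ∈ B.edgeSet

namespace IsThreePathPartition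

variable {α : Type*}

theorem singleton (g : Fin 3 ↪ α) :
    IsThreePathPartition (threePath g).edgeSet {threePath g} where
  exists_eq := by simp
  edgeSet_subset := by simp
  existsUnique_block e he := ⟨_, ⟨rfl, he⟩, fun _ h => h.1⟩

theorem iUnion {ι : Type*} {E : ι → Set (Sym2 α)} {𝓑 : ι → Set (LabelledGraph α)}
    (h : ∀ i, IsThreePathPartition (E i) (𝓑 i)) (hE : Pairwise (Function.onFun Disjoint E)) :
    IsThreePathPartition (⋃ i, E i) (⋃ i, 𝓑 i) where
  exists_eq B hB := by
    obtain ⟨i, hi⟩ := Set.mem_iUnion.1 hB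
    exact (h i).exists_eq B hi
  edgeSet_subset B hB := by
    obtain ⟨i, hi⟩ := Set.mem_iUnion.1 hB
    exact ((h i).edgeSet_subset B hi).trans (Set.subset_iUnion E i)
  existsUnique_block e he := by
    obtain ⟨i, hi⟩ := Set.mem_iUnion.1 he
    obtain ⟨B, hB, huniq⟩ := (h i).existsUnique_block e hi
    refine ⟨B, ⟨Set.mem_iUnion_of_mem i hB.1, hB.2⟩, fun C hC => ?_⟩
    obtain ⟨j, hj⟩ := Set.mem_iUnion.1 hC.1
    obtain rfl : j = i := by
      by_contra hne
      exact Set.disjoint_left.1 (hE hne) ((h j).edgeSet_subset C hj hC.2) hi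
    exact huniq C ⟨hj, hC.2⟩

theorem union {E F : Set (Sym2 α)} {𝓑 𝓒 : Set (LabelledGraph α)}
    (hE : IsThreePathPartition E 𝓑) (hF : IsThreePathPartition F 𝓒) (hEF : Disjoint E F) :
    IsThreePathPartition (E ∪ F) (𝓑 ∪ 𝓒) := by
  rw [Set.union_eq_iUnion, Set.union_eq_iUnion]
  refine iUnion (fun b => by cases b <;> assumption) ?_
  rintro (_ | _) (_ | _) hne
  · exact absurd rfl hne
  · exact hEF.symm
  · exact hEF
  · exact absurd rfl hne

/-- A three-vertex path has no isolated vertex, so control of its edges also controls its vertices.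
-/
theorem isDesignOfOrder {Y : Finset α} {𝓑 : Set (LabelledGraph α)}
    (h : IsThreePathPartition (completeOn (Y : Set α)).edgeSet 𝓑) :
    IsDesignOfOrder (SimpleGraph.pathGraph 3) Y.card 𝓑 := by
  refine ⟨Y, rfl, fun B hB => ?_, fun B hB => ?_, h.existsUnique_block⟩
  · refine ⟨fun x hx => ?_, fun x y hxy =>
    SimpleGraph.Subgraph.mem_edgeSet.1
      (h.edgeSet_subset B hB (SimpleGraph.Subgraph.mem_edgeSet.2 hxy))⟩
    obtain ⟨g, rfl⟩ := h.exists_eq B hB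
    obtain ⟨e, he, hxe⟩ := exists_mem_edgeSet_threePath g hx
    exact SimpleGraph.Subgraph.mem_verts_of_mem_edge (h.edgeSet_subset _ hB he) hxe
  · obtain ⟨g, rfl⟩ := h.exists_eq B hB
    exact threePath_iso g

theorem even_card {E : Finset (Sym2 α)} {𝓑 : Set (LabelledGraph α)}
    (h : IsThreePathPartition (E : Set (Sym2 α)) 𝓑) : Even E.card := by
  classical
  -- `φ` sends an edge to its block; each nonempty fibre is the edge set of a block, of size two.
  choose! φ hφ huniq using h.existsUnique_block
  rw [Finset.card_eq_sum_card_image φ]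
  refine Finset.even_sum _ fun B hB => ?_
  obtain ⟨e, he, rfl⟩ := Finset.mem_image.1 hB
  have hmem := (hφ e he).1
  have hset : ((E.filter fun x => φ x = φ e : Finset (Sym2 α)) : Set (Sym2 α)) =
      (φ e).edgeSet := by
    ext x
    simp only [Finset.coe_filter, Set.mem_ofPred_eq]
    constructor
    · rintro ⟨hx, hxe⟩
      exact hxe ▸ (hφ x hx).2
    · intro hx
      have hxE := h.edgeSet_subset _ hmem hx
      exact ⟨hxE, (huniq x hxE _ ⟨hmem, hx⟩).symm⟩
  rw [← Set.ncard_coe_finset, hset]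
  obtain ⟨g, hg⟩ := h.exists_eq _ hmem
  rw [hg]
  exact even_ncard_threePath_edgeSet g

end IsThreePathPartition

/-! ### Partitions obtained by assigning edges to their ends -/

theorem exists_threePath_edgeSet_eq {α : Type*} {x : α} {e f : Sym2 α} (he : ¬e.IsDiag)
    (hf : ¬f.IsDiag) (hxe : x ∈ e) (hxf : x ∈ f) (hef : e ≠ f) :
    ∃ g : Fin 3 ↪ α, (threePath g).edgeSet = {e, f} := by
  obtain ⟨a, rfl⟩ := hxe
  obtain ⟨b, rfl⟩ := hxf
  have ha : x ≠ a := by simpa using he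
  have hb : x ≠ b := by simpa using hf
  have hab : a ≠ b := by rintro rfl; exact hef rfl
  refine ⟨⟨![a, x, b], ?_⟩, ?_⟩
  · intro i j
    fin_cases i <;> fin_cases j <;> simp [ha, hb, hab, ha.symm, hb.symm, hab.symm]
  · rw [threePath_edgeSet]
    change ({s(a, x), s(x, b)} : Set (Sym2 α)) = {s(x, a), s(x, b)}
    rw [Sym2.eq_swap (a := a)]

/-- An even number of edges through a common vertex can be partitioned into paths. -/
theorem exists_threePathPartition_of_forall_mem {α : Type*} {x : α} {E : Finset (Sym2 α)}
    (hdiag : ∀ e ∈ E, ¬e.IsDiag) (hx : ∀ e ∈ E, x ∈ e) (hE : Even E.card) :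
    ∃ 𝓑, IsThreePathPartition (E : Set (Sym2 α)) 𝓑 := by
  obtain ⟨m, hm⟩ := hE
  let φ : Fin m × Fin 2 ≃ E :=
    finProdFinEquiv.trans ((finCongr (by omega)).trans E.equivFin.symm)
  have key : ∀ i, ∃ g : Fin 3 ↪ α,
      (threePath g).edgeSet = {(φ (i, 0) : Sym2 α), (φ (i, 1) : Sym2 α)} := fun i =>
    exists_threePath_edgeSet_eq (hdiag _ (φ _).2) (hdiag _ (φ _).2) (hx _ (φ _).2)
      (hx _ (φ _).2) fun h => by simpa using φ.injective (Subtype.ext h)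
  choose g hg using key
  refine ⟨⋃ i, {threePath (g i)}, ?_⟩
  have hU : (E : Set (Sym2 α)) = ⋃ i, (threePath (g i)).edgeSet := by
    ext e
    simp only [hg, Set.mem_iUnion, Set.mem_insert_iff, Set.mem_singleton_iff, Finset.mem_coe]
    constructor
    · intro he
      obtain ⟨⟨i, j⟩, hij⟩ := φ.surjective ⟨e, he⟩
      refine ⟨i, ?_⟩
      fin_cases j
      · exact Or.inl (congrArg Subtype.val hij).symm
      · exact Or.inr (congrArg Subtype.val hij).symm
    · rintro ⟨i, rfl | rfl⟩ <;> exact (φ _).2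
  rw [hU]
  refine .iUnion (fun i => .singleton (g i)) fun i j hij => ?_
  have hne : ∀ a b, (φ (i, a) : Sym2 α) ≠ φ (j, b) := fun a b h =>
    hij (congrArg Prod.fst (φ.injective (Subtype.ext h)))
  simp only [Function.onFun, hg]
  simp [hne, eq_comm]

/-- Reduces path partitions to a parity problem: the edges assigned to `x` all pass through `x` and
can be paired. -/
theorem exists_threePathPartition_of_even_fibers {α : Type*} [DecidableEq α]
    {E : Finset (Sym2 α)} (hdiag : ∀ e ∈ E, ¬e.IsDiag) (c : Sym2 α → α) (hc : ∀ e ∈ E, c e ∈ e)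
    (heven : ∀ x, Even (E.filter fun e => c e = x).card) :
    ∃ 𝓑, IsThreePathPartition (E : Set (Sym2 α)) 𝓑 := by
  have key : ∀ x, ∃ 𝓑, IsThreePathPartition
      ((E.filter fun e => c e = x : Finset (Sym2 α)) : Set (Sym2 α)) 𝓑 := fun x =>
    exists_threePathPartition_of_forall_mem (x := x)
      (fun e he => hdiag e (Finset.mem_filter.1 he).1)
      (fun e he => by
        obtain ⟨heE, rfl⟩ := Finset.mem_filter.1 he
        exact hc e heE) (heven x)
  choose 𝓑 h𝓑 using key
  refine ⟨⋃ x, 𝓑 x, ?_⟩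
  have hU : (E : Set (Sym2 α)) =
      ⋃ x, ((E.filter fun e => c e = x : Finset (Sym2 α)) : Set (Sym2 α)) := by
    ext e
    simp
  rw [hU]
  refine .iUnion h𝓑 fun x y hxy => ?_
  refine Set.disjoint_left.2 fun e he he' => hxy ?_
  exact (Finset.mem_filter.1 he).2.symm.trans (Finset.mem_filter.1 he').2

/-- A graph with an even number of edges and a vertex adjacent to all others can be partitioned
into three-vertex paths. -/
theorem exists_threePathPartition_of_universal {α : Type*} {Y : Finset α} {y : α}
    {E : Finset (Sym2 α)} (hdiag : ∀ e ∈ E, ¬e.IsDiag) (hY : ∀ e ∈ E, ∀ x ∈ e, x ∈ Y)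
    (hy : ∀ x ∈ Y, x ≠ y → s(y, x) ∈ E) (hE : Even E.card) :
    ∃ 𝓑, IsThreePathPartition (E : Set (Sym2 α)) 𝓑 := by
  classical
  let c₀ : Sym2 α → α := fun e => e.out.1
  have hc₀ : ∀ e, c₀ e ∈ e := fun e => Sym2.out_fst_mem e
  -- `d x` collects the edges off `y` assigned to `x`; its parity decides which end receives `s(y,
  -- x)`.
  obtain ⟨d, hd⟩ : ∃ d : α → Finset (Sym2 α), ∀ x e, e ∈ d x ↔ e ∈ E ∧ y ∉ e ∧ c₀ e = x :=
    ⟨fun x => E.filter fun e => y ∉ e ∧ c₀ e = x, fun x e => Finset.mem_filter⟩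
  have hex : ∀ e, ∃ z ∈ e, (y ∉ e → z = c₀ e) ∧
      ∀ x, e = s(y, x) → (Odd (d x).card → z = x) ∧ (¬Odd (d x).card → z = y) := by
    intro e
    by_cases h : y ∈ e
    · obtain ⟨x, rfl⟩ := h
      have hx : ∀ x', s(y, x) = s(y, x') → x = x' := fun _ => Sym2.congr_right.1
      by_cases hodd : Odd (d x).card
      · refine ⟨x, Sym2.mem_mk_right y x, fun h => absurd (Sym2.mem_mk_left y x) h, fun x' h => ?_⟩
        obtain rfl := hx x' h
        exact ⟨fun _ => rfl, fun h => absurd hodd h⟩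
      · refine ⟨y, Sym2.mem_mk_left y x, fun h => absurd (Sym2.mem_mk_left y x) h, fun x' h => ?_⟩
        obtain rfl := hx x' h
        exact ⟨fun h => absurd h hodd, fun _ => rfl⟩
    · refine ⟨c₀ e, hc₀ e, fun _ => rfl, fun x hx => absurd ?_ h⟩
      rw [hx]
      exact Sym2.mem_mk_left y x
  choose c hc hcn hcy using hex
  have hmem : ∀ x e, x ≠ y →
      (e ∈ E.filter (fun e => c e = x) ↔ e ∈ d x ∨ (e ∈ E ∧ e = s(y, x) ∧ Odd (d x).card)) := by
    intro x e hxy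
    rw [Finset.mem_filter, hd]
    by_cases h : y ∈ e
    · obtain ⟨z, rfl⟩ := h
      have hz := hcy _ z rfl
      simp only [Sym2.mem_mk_left, not_true_eq_false, false_and, and_false, false_or,
        Sym2.congr_right, and_congr_right_iff]
      intro _
      by_cases hodd : Odd (d z).card
      · rw [hz.1 hodd]
        exact ⟨fun h => ⟨h, h ▸ hodd⟩, fun h => h.1⟩
      · rw [hz.2 hodd]
        exact ⟨fun h => absurd h.symm hxy, fun h => absurd (h.1 ▸ h.2) hodd⟩
    · have hne : e ≠ s(y, x) := by
        rintro rfl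
        exact h (Sym2.mem_mk_left y x)
      simp [hcn e h, h, hne]
  have hne : ∀ x, x ≠ y → Even (E.filter fun e => c e = x).card := by
    intro x hxy
    by_cases hodd : Odd (d x).card
    · have hxY : x ∈ Y := by
        obtain ⟨e, he⟩ := Finset.card_pos.1 hodd.pos
        obtain ⟨heE, -, rfl⟩ := (hd _ _).1 he
        exact hY e heE _ (hc₀ e)
      have hfil : (E.filter fun e => c e = x) = insert s(y, x) (d x) := by
        ext e
        rw [hmem x e hxy, Finset.mem_insert, or_comm]
        refine or_congr_left ⟨fun h => h.2.1, ?_⟩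
        rintro rfl
        exact ⟨hy x hxY hxy, rfl, hodd⟩
      rw [hfil, Finset.card_insert_of_notMem (by simp [hd])]
      exact hodd.add_one
    · have hfil : (E.filter fun e => c e = x) = d x := by
        ext e
        rw [hmem x e hxy]
        simp [hodd]
      rw [hfil]
      exact Nat.not_odd_iff_even.1 hodd
  refine exists_threePathPartition_of_even_fibers hdiag c (fun e _ => hc e) fun x => ?_
  by_cases hx : x = y
  · subst hx
    -- The fibre over `y` inherits its parity from the total and the other fibres.
    have hsum := Finset.card_eq_sum_card_fiberwise (f := c) (s := E) (t := insert x Y)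
      fun e he => Finset.mem_insert_of_mem (hY e he _ (hc e))
    rw [← Finset.add_sum_erase _ _ (Finset.mem_insert_self x Y)] at hsum
    rw [hsum, Nat.even_add] at hE
    exact hE.2 (Finset.even_sum _ fun z hz => hne z (Finset.ne_of_mem_erase hz))
  · exact hne x hx

/-! ### Paths inside the blocks, and the order of a path design -/

theorem mem_edgeSet_completeOn {α : Type*} {X : Set α} {x y : α} :
    s(x, y) ∈ (completeOn X).edgeSet ↔ x ∈ X ∧ y ∈ X ∧ x ≠ y := by
  simp [completeOn]

/-- A path on at least `3 * (#A + 1)` vertices contains a three-vertex path avoiding `A`. -/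
theorem exists_threePath_le_disjoint {α : Type*} {k : ℕ} {B : LabelledGraph α}
    (φ : B.coe ≃g SimpleGraph.pathGraph k) (A : Finset α) (hA : 3 * (A.card + 1) ≤ k) :
    ∃ g : Fin 3 ↪ α, threePath g ≤ B ∧ ∀ i, g i ∉ A := by
  let p : Fin k → α := fun i => (φ.symm i : α)
  have hp : Function.Injective p := Subtype.val_injective.comp φ.symm.injective
  -- Disjoint windows of three consecutive positions. If `A` met all of them, `#A + 1` windows would
  -- inject into `A`.
  let w : Fin (A.card + 1) → Fin 3 → Fin k := fun i j => ⟨3 * i + j, by omega⟩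
  obtain ⟨i, hi⟩ : ∃ i, ∀ j, p (w i j) ∉ A := by
    by_contra! hcon
    choose j hj using hcon
    have hinj : Function.Injective fun i => (⟨p (w i (j i)), hj i⟩ : A) := by
      intro a b hab
      beta_reduce at hab
      rw [Subtype.mk.injEq] at hab
      have := hp hab
      simp only [w, Fin.mk.injEq] at this
      omega
    have := Fintype.card_le_of_injective _ hinj
    simp at this
  have hw : Function.Injective (w i) := fun a b hab => by
    simp only [w, Fin.mk.injEq] at hab
    omega
  refine ⟨⟨fun j => p (w i j), hp.comp hw⟩, ⟨?_, ?_⟩, hi⟩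
  · rw [threePath_verts]
    rintro _ ⟨j, rfl⟩
    exact (φ.symm (w i j)).2
  · intro x y hxy
    obtain ⟨a, b, hab, rfl, rfl⟩ := (threePath_adj _ _ _).1 hxy
    have : (SimpleGraph.pathGraph k).Adj (w i a) (w i b) := by
      rw [SimpleGraph.pathGraph_adj] at hab ⊢
      simp only [w]
      omega
    exact (φ.symm.map_adj_iff).2 this

/-- Two vertices give an edge, hence a block. The bound ensures that there are enough vertices to
delete. -/
theorem le_of_isDesignOfOrder_pathGraph {α : Type*} {k v : ℕ} (hv : 1 < v)
    {𝓑 : Set (LabelledGraph α)} (h : IsDesignOfOrder (SimpleGraph.pathGraph k) v 𝓑) :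
    k ≤ v := by
  obtain ⟨X, rfl, hX⟩ := h
  obtain ⟨x, hx, y, hy, hxy⟩ := Finset.one_lt_card.1 hv
  obtain ⟨B, ⟨hB, -⟩, -⟩ := hX.existsUnique_block s(x, y) (mem_edgeSet_completeOn.2 ⟨hx, hy, hxy⟩)
  obtain ⟨φ⟩ := hX.block_iso B hB
  have hmem : ∀ i, (φ.symm i : α) ∈ X := fun i => (hX.block_le B hB).1 (φ.symm i).2
  have hinj : Function.Injective fun i => (⟨φ.symm i, hmem i⟩ : X) := fun a b hab => by
    beta_reduce at hab
    rw [Subtype.mk.injEq] at hab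
    exact φ.symm.injective (Subtype.ext hab)
  simpa using Fintype.card_le_of_injective _ hinj

/-! ### Completion to a design, and the down-link -/

theorem even_choose_two_of_modEq {n : ℕ} (hn : n ≡ 0 [MOD 4] ∨ n ≡ 1 [MOD 4]) :
    Even (n.choose 2) := by
  rw [Nat.choose_two_right]
  obtain ⟨q, rfl | rfl⟩ : ∃ q, n = 4 * q ∨ n = 4 * q + 1 := by
    refine ⟨n / 4, ?_⟩
    simp only [Nat.ModEq] at hn
    omega
  · rw [show 4 * q * (4 * q - 1) = 2 * (2 * (q * (4 * q - 1))) by ring]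
    simp
  · rw [show (4 * q + 1) * (4 * q + 1 - 1) = 2 * (2 * (q * (4 * q + 1))) by
      rw [Nat.add_sub_cancel]; ring]
    simp

/-- Pairwise edge-disjoint three-vertex paths in a complete graph of order `n ≡ 0, 1 (mod 4)` that
miss one of its vertices extend to a `P₃`-design. -/
theorem exists_isDesignOfOrder_superset {α : Type*} {Y : Finset α} {y : α} (hy : y ∈ Y)
    (hmod : Y.card ≡ 0 [MOD 4] ∨ Y.card ≡ 1 [MOD 4]) {F : Set (Sym2 α)}
    {𝓒 : Set (LabelledGraph α)} (h𝓒 : IsThreePathPartition F 𝓒)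
    (hF : F ⊆ (completeOn (Y : Set α)).edgeSet) (hyF : ∀ e ∈ F, y ∉ e) :
    ∃ 𝓑, IsDesignOfOrder (SimpleGraph.pathGraph 3) Y.card 𝓑 ∧ 𝓒 ⊆ 𝓑 := by
  classical
  let K : Finset (Sym2 α) := Y.offDiag.image Sym2.mk.uncurry
  have hK : (K : Set (Sym2 α)) = (completeOn (Y : Set α)).edgeSet := by
    ext e
    induction e with
    | _ a b =>
      rw [mem_edgeSet_completeOn]
      simp only [K, Finset.coe_image, Set.mem_image, Finset.mem_coe, Finset.mem_offDiag,
        Prod.exists]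
      grind
  have hKcard : K.card = Y.card.choose 2 := Sym2.card_image_offDiag Y
  have hFin : F.Finite := (K.finite_toSet.subset (hK ▸ hF))
  lift F to Finset (Sym2 α) using hFin
  have hFK : F ⊆ K := Finset.coe_subset.1 (hK ▸ hF)
  have heven : Even (K \ F).card := by
    have h₁ := even_choose_two_of_modEq hmod
    rw [← hKcard, ← Finset.card_sdiff_add_card_eq_card hFK, Nat.even_add] at h₁
    exact h₁.2 h𝓒.even_card
  have hmemK : ∀ a b, s(a, b) ∈ K ↔ a ∈ Y ∧ b ∈ Y ∧ a ≠ b := fun a b => by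
    rw [← Finset.mem_coe, hK, mem_edgeSet_completeOn]
    rfl
  obtain ⟨𝓓, h𝓓⟩ := exists_threePathPartition_of_universal (Y := Y) (y := y) (E := K \ F)
    (fun e he => by
      induction e with
      | _ a b => simpa using ((hmemK a b).1 (Finset.mem_sdiff.1 he).1).2.2)
    (fun e he x hx => by
      obtain ⟨b, rfl⟩ := hx
      exact ((hmemK x b).1 (Finset.mem_sdiff.1 he).1).1)
    (fun x hx hxy => Finset.mem_sdiff.2 ⟨(hmemK y x).2 ⟨hy, hx, hxy.symm⟩,
      fun h => hyF _ h (Sym2.mem_mk_left y x)⟩) heven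
  refine ⟨𝓒 ∪ 𝓓, IsThreePathPartition.isDesignOfOrder ?_, Set.subset_union_left⟩
  have := h𝓒.union h𝓓 (by rw [Finset.coe_sdiff]; exact Set.disjoint_sdiff_right)
  rwa [← Finset.coe_union, Finset.union_sdiff_of_subset hFK, hK] at this

theorem mem_downLinkSpectrum₂_of_lt_add {α : Type*} [Infinite α] {k v n m : ℕ}
    (hm : 3 * (m + 1) ≤ k) (hmv : m ≤ v) (hn : v < n + m)
    (hmod : n ≡ 0 [MOD 4] ∨ n ≡ 1 [MOD 4]) :
    n ∈ downLinkSpectrum₂ α (SimpleGraph.pathGraph k) (SimpleGraph.pathGraph 3) v := by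
  classical
  rintro 𝓑 ⟨X, rfl, hX⟩
  obtain ⟨A, hAX, rfl⟩ := Finset.exists_subset_card_eq hmv
  have hcard := Finset.card_sdiff_add_card_eq_card hAX
  obtain ⟨Y, hXY, rfl⟩ := Infinite.exists_superset_card_eq (X \ A) n (by omega)
  -- The strict inequality `v < n + m` is what leaves room for `y`.
  obtain ⟨y, hyY, hy⟩ := Finset.exists_mem_notMem_of_card_lt_card (s := X \ A) (t := Y) (by omega)
  have key : ∀ B : 𝓑, ∃ g : Fin 3 ↪ α, threePath g ≤ B.1 ∧ ∀ i, g i ∉ A := fun B => by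
    obtain ⟨φ⟩ := hX.block_iso B.1 B.2
    exact exists_threePath_le_disjoint φ A hm
  choose g hg hgA using key
  have hle : ∀ B, (threePath (g B)).edgeSet ⊆ B.1.edgeSet := fun B =>
    SimpleGraph.Subgraph.edgeSet_mono (hg B)
  have hpart : IsThreePathPartition (⋃ B, (threePath (g B)).edgeSet) (⋃ B, {threePath (g B)}) := by
    refine .iUnion (fun B => .singleton (g B)) fun B C hBC => ?_
    refine Set.disjoint_left.2 fun e heB heC => hBC (Subtype.ext ?_)
    have he : e ∈ (completeOn (X : Set α)).edgeSet :=
      SimpleGraph.Subgraph.edgeSet_mono (hX.block_le _ B.2) (hle B heB)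
    exact (hX.existsUnique_block e he).unique ⟨B.2, hle B heB⟩ ⟨C.2, hle C heC⟩
  have hmem : ∀ B : 𝓑, ∀ x ∈ (threePath (g B)).verts, x ∈ X \ A := by
    intro B x hx
    refine Finset.mem_sdiff.2 ⟨(hX.block_le _ B.2).1 ((hg B).1 hx), ?_⟩
    rw [threePath_verts] at hx
    obtain ⟨i, rfl⟩ := hx
    exact hgA B i
  obtain ⟨𝓑', h𝓑', hsub⟩ := exists_isDesignOfOrder_superset hyY hmod hpart
    (fun e he => by
      obtain ⟨B, hB⟩ := Set.mem_iUnion.1 he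
      induction e with
      | _ a b =>
        have hab : (threePath (g B)).Adj a b := hB
        exact mem_edgeSet_completeOn.2
          ⟨hXY (hmem B a hab.fst_mem), hXY (hmem B b hab.snd_mem), hab.ne⟩)
    (fun e he hye => by
      obtain ⟨B, hB⟩ := Set.mem_iUnion.1 he
      exact hy (hmem B y (SimpleGraph.Subgraph.mem_verts_of_mem_edge hB hye)))
  exact ⟨𝓑', h𝓑', fun B => ⟨threePath (g B), hsub (Set.mem_iUnion_of_mem B rfl)⟩, hg⟩

theorem mainTheorem10 {α : Type*} [Infinite α] (k : ℕ) (hk : 4 < k) (v : ℕ) (hv : 1 < v)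
    (hadm : IsAdmissibleOrder α (SimpleGraph.pathGraph k) v) :
    {n : ℕ | (v : ℤ) - ⌊((k : ℚ) - 6) / 3⌋ ≤ (n : ℤ) ∧ (n ≡ 0 [MOD 4] ∨ n ≡ 1 [MOD 4])} ⊆
        downLinkSpectrum₂ α (SimpleGraph.pathGraph k) (SimpleGraph.pathGraph 3) v ∧
      downLinkSpectrum₂ α (SimpleGraph.pathGraph k) (SimpleGraph.pathGraph 3) v ⊆
        downLinkSpectrum₁ α (SimpleGraph.pathGraph k) (SimpleGraph.pathGraph 3) v := by
  obtain ⟨𝓑, h𝓑⟩ := hadm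
  have hkv := le_of_isDesignOfOrder_pathGraph hv h𝓑
  refine ⟨?_, fun n hn => ⟨𝓑, h𝓑, hn 𝓑 h𝓑⟩⟩
  rintro n ⟨hn, hmod⟩
  have hfloor : ⌊((k : ℚ) - 6) / 3⌋ = ((k : ℤ) - 6) / 3 := by
    exact_mod_cast Rat.floor_intCast_div_natCast ((k : ℤ) - 6) 3
  rw [hfloor] at hn
  -- This `m` is `⌊(k - 6)/3⌋ + 1`; for `k = 5` the floor is `-1` and nothing is deleted.
  exact mem_downLinkSpectrum₂_of_lt_add (m := k / 3 - 1) (by omega) (by omega) (by omega) hmod
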